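/- Let $p>2$ be a prime number and let $G$ be a nontrivial finite $p$-group. For $x\in G$ let $b(x)=\log_p|G:Z_G(x)|$, where $Z_G(x)$ is the centralizer of $x$ in $G$, and let $b(G)=\max_{x\in G}b(x)$ be the breadth of $G$. Let $f(x)=x(x+1)$, and let $f^k$ denote its $k$-th iterate. Then there exists a characteristic subgroup $N$ of $G$, which is even invariant under all surjective endomorphisms of $G$, such that 1. $\log_2|G:N|\le f^{\,b(G)+1}\bigl(b(G)\log_2 p\bigr)$, and 2. $cl(N)\le b(G)+1$, where $cl(N)$ denotes the nilpotency class of $N$. -/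

import Mathlib

/-- The breadth `b(x)` of an element `x` of a finite `p`-group `G`: the exponent `k` with
`|G : Z_G(x)| = p ^ k` (see `pow_elementBreadth`). -/
noncomputable def elementBreadth (p : ℕ) {G : Type*} [Group G] (x : G) : ℕ :=
  Nat.log p (Subgroup.centralizer {x}).index

/-- In a finite `p`-group, `elementBreadth p x` is the exact logarithm of the index of the
centralizer of `x`. -/
theorem pow_elementBreadth {p : ℕ} [hp : Fact p.Prime] {G : Type*} [Group G] [Finite G]
    (hG : IsPGroup p G) (x : G) :
    p ^ elementBreadth p x = (Subgroup.centralizer {x}).index := by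
  obtain ⟨n, hn⟩ := hG.index (Subgroup.centralizer {x})
  rw [elementBreadth, hn, Nat.log_pow hp.out.one_lt]

/-- The breadth `b(G)` of a finite `p`-group `G`: the maximum of `b(g)` over `g ∈ G`. -/
noncomputable def groupBreadth (p : ℕ) (G : Type*) [Group G] : ℕ :=
  ⨆ g : G, elementBreadth p g

/-- In a finite group, the supremum defining the breadth is an attained maximum. -/
theorem isGreatest_groupBreadth (p : ℕ) (G : Type*) [Group G] [Finite G] :
    IsGreatest (Set.range fun g : G => elementBreadth p g) (groupBreadth p G) :=
  ⟨Set.Nonempty.csSup_mem (Set.range_nonempty _) (Set.finite_range _),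
    fun _ h => le_csSup (Set.finite_range _).bddAbove h⟩

namespace Subgroup

open scoped commutatorElement

variable {G : Type*} [Group G]

/-! Take `N` to be the centralizer of `G'`: it is characteristic and has class at most 2, so the
work lies in bounding its index. Choose `x` with the largest conjugacy class and let `F` be
generated by `x` and at most `b` elements, so that `F` contains a transversal of the centralizer of
`x`. Then `V`, the normal closure of `x`, lies in `F`, and the centralizer of `F` has index at most
`p ^ (b * (b + 1))`. By maximality of `x`, this centralizer is central modulo `V`, so a Schur-type
bound controls the order of `(G/V)'`. Hence `G'` lies in an overgroup of `V` obtained by adjoining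
boundedly many elements, each costing a factor of at most `p ^ b` in the index of the centralizer.
-/

/-! ### Bounding the commutator subgroup by the index of the center -/

theorem exists_notMem_center_forall_commutatorElement_mem_center {p : ℕ} [Fact p.Prime]
    [Finite G] (hG : IsPGroup p G) (hc : center G ≠ ⊤) :
    ∃ u : G, u ∉ center G ∧ ∀ g : G, ⁅u, g⁆ ∈ center G := by
  have : Nontrivial (G ⧸ center G) := QuotientGroup.nontrivial_iff.2 hc
  have := (hG.to_quotient (center G)).center_nontrivial
  obtain ⟨⟨v, hv⟩, hv1⟩ := exists_ne (1 : center (G ⧸ center G))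
  obtain ⟨u, rfl⟩ := QuotientGroup.mk_surjective v
  refine ⟨u, fun hu => hv1 (Subtype.ext ((QuotientGroup.eq_one_iff u).2 hu)), fun g => ?_⟩
  rw [← QuotientGroup.eq_one_iff]
  have h := mem_center_iff.1 hv (g : G ⧸ center G)
  exact commutatorElement_eq_one_iff_mul_comm.2 h.symm

/-- If all commutators `⁅u, g⁆` are central, they form a central subgroup, of order the index of
the centralizer of `u`. -/
theorem exists_le_center_commutatorElement_mem_card_eq_index_centralizer {u : G}
    (hu : ∀ g : G, ⁅u, g⁆ ∈ center G) :
    ∃ R : Subgroup G, R ≤ center G ∧ (∀ g : G, ⁅u, g⁆ ∈ R) ∧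
      Nat.card R = (centralizer {u}).index := by
  let f : G →* G := MonoidHom.mk' (fun g => ⁅u, g⁆) fun a b => by
    rw [commutatorElement_mul_right_eq_mul_conj, mul_assoc _ a,
      mem_center_iff.1 (hu b) a, mul_assoc, mul_assoc, mul_inv_cancel, mul_one]
  refine ⟨f.range, ?_, fun g => ⟨g, rfl⟩, ?_⟩
  · rintro _ ⟨g, rfl⟩
    exact hu g
  · rw [← index_ker]
    congr 1
    ext g
    rw [MonoidHom.mem_ker, mem_centralizer_singleton_iff]
    exact (commutatorElement_eq_one_iff_mul_comm (g₁ := u) (g₂ := g)).trans eq_comm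

theorem card_commutator_le_card_mul_card_commutator_quotient [Finite G] (R : Subgroup G)
    [R.Normal] :
    Nat.card (_root_.commutator G) ≤ Nat.card R * Nat.card (_root_.commutator (G ⧸ R)) := by
  let f : _root_.commutator G →* G ⧸ R := (QuotientGroup.mk' R).comp (_root_.commutator G).subtype
  have hrange : f.range = _root_.commutator (G ⧸ R) := by
    rw [MonoidHom.range_comp, range_subtype, _root_.commutator_def, map_commutator,
      map_top_of_surjective _ (QuotientGroup.mk'_surjective R), _root_.commutator_def]
  have hker : Nat.card f.ker ≤ Nat.card R := by
    rw [← card_map_of_injective (_root_.commutator G).subtype_injective]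
    refine card_le_of_le (map_le_iff_le_comap.2 fun x hx => ?_)
    exact (QuotientGroup.eq_one_iff (x : G)).1 hx
  rw [← f.ker.card_mul_index, index_ker, hrange]
  exact Nat.mul_le_mul_right _ hker

theorem le_relIndex_of_lt {p : ℕ} [hp : Fact p.Prime] [Finite G] (hG : IsPGroup p G)
    {H K : Subgroup G} (h : H < K) : p ≤ H.relIndex K := by
  obtain ⟨n, hn⟩ := (hG.to_subgroup K).index (H.subgroupOf K)
  change H.relIndex K = p ^ n at hn
  have hn0 : n ≠ 0 := by
    rintro rfl
    exact h.not_ge (relIndex_eq_one.1 hn)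
  exact hn ▸ Nat.le_self_pow hn0 p

theorem index_le_pow_of_lt {p : ℕ} [hp : Fact p.Prime] [Finite G] (hG : IsPGroup p G)
    {H K : Subgroup G} (h : H < K) {n : ℕ} (hn : H.index ≤ p ^ (n + 1)) : K.index ≤ p ^ n := by
  refine le_of_mul_le_mul_left ?_ hp.out.pos
  calc p * K.index ≤ H.relIndex K * K.index := Nat.mul_le_mul_right _ (le_relIndex_of_lt hG h)
    _ = H.index := relIndex_mul_index h.le
    _ ≤ p ^ (n + 1) := hn
    _ = p * p ^ n := pow_succ' p n

/-- A finite `p`-group whose center has index at most `p ^ n` has commutator subgroup of order at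
most `p ^ (n * n)`. -/
theorem card_commutator_le_pow_of_index_center_le {p : ℕ} [hp : Fact p.Prime] (n : ℕ) :
    ∀ {G : Type*} [Group G] [Finite G], IsPGroup p G → (center G).index ≤ p ^ n →
      Nat.card (_root_.commutator G) ≤ p ^ (n * n) := by
  induction n with
  | zero =>
    intro G _ _ hG h
    have h1 : (center G).index = 1 :=
      le_antisymm h (Nat.one_le_iff_ne_zero.2 index_ne_zero_of_finite)
    rw [(commutator_eq_bot_iff_center_eq_top G).2 (index_eq_one.1 h1), card_bot]
    exact Nat.one_le_pow _ _ hp.out.pos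
  | succ n ih =>
    intro G _ _ hG h
    by_cases hc : center G = ⊤
    · rw [(commutator_eq_bot_iff_center_eq_top G).2 hc, card_bot]
      exact Nat.one_le_pow _ _ hp.out.pos
    obtain ⟨u, hu, huc⟩ := exists_notMem_center_forall_commutatorElement_mem_center hG hc
    obtain ⟨R, hRc, hRu, hR⟩ :=
      exists_le_center_commutatorElement_mem_card_eq_index_centralizer huc
    have hRn : R.Normal := ⟨fun r hr g => by
      rw [mem_center_iff.1 (hRc hr) g, mul_inv_cancel_right]; exact hr⟩
    have hlt : center G < centralizer {u} :=
      lt_of_le_of_ne (center_le_centralizer _) fun heq =>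
        hu (heq ▸ mem_centralizer_singleton_iff.2 rfl)
    -- Modulo `R` the noncentral `u` becomes central, so the index of the center drops and induction
    -- applies to `G ⧸ R`.
    have hlt' : center G < (center (G ⧸ R)).comap (QuotientGroup.mk' R) := by
      refine lt_of_le_of_ne (fun z hz => ?_) fun heq => hu ?_
      · rw [mem_comap, mem_center_iff]
        intro g
        obtain ⟨g, rfl⟩ := QuotientGroup.mk_surjective g
        exact congrArg (QuotientGroup.mk' R) (mem_center_iff.1 hz g)
      · rw [heq, mem_comap, mem_center_iff]
        intro g
        obtain ⟨g, rfl⟩ := QuotientGroup.mk_surjective g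
        exact (commutatorElement_eq_one_iff_mul_comm.1
          ((QuotientGroup.eq_one_iff _).2 (hRu g))).symm
    have key := ih (hG.to_quotient R) (by
      rw [← index_comap_of_surjective (center (G ⧸ R)) (QuotientGroup.mk'_surjective R)]
      exact index_le_pow_of_lt hG hlt' h)
    calc Nat.card (_root_.commutator G) ≤ Nat.card R * Nat.card (_root_.commutator (G ⧸ R)) :=
          card_commutator_le_card_mul_card_commutator_quotient R
      _ ≤ p ^ n * p ^ (n * n) := Nat.mul_le_mul (hR ▸ index_le_pow_of_lt hG hlt h) key
      _ = p ^ (n + n * n) := (pow_add p n _).symm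
      _ ≤ p ^ ((n + 1) * (n + 1)) := Nat.pow_le_pow_right hp.out.pos (by nlinarith)

/-! ### Centralizers and transversals when elements are adjoined -/

theorem index_centralizer_sup_zpowers_le [Finite G] (K : Subgroup G) (x : G) :
    (centralizer ((K ⊔ zpowers x : Subgroup G) : Set G)).index ≤
      (centralizer (K : Set G)).index * (centralizer {x}).index := by
  refine (index_antitone (H := centralizer (K : Set G) ⊓ centralizer {x}) ?_).trans index_inf_le
  rw [le_centralizer_iff]
  refine sup_le (le_centralizer_iff.1 inf_le_left) (zpowers_le.2 (mem_centralizer_iff.2 ?_))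
  exact fun g hg => (mem_centralizer_singleton_iff.1 hg.2)

/-- If every element of a finite `p`-group has breadth at most `b`, then the index of the
centralizer grows by a factor of at most `p ^ (b * e)` when passing from a subgroup to an
overgroup of relative index at most `p ^ e`. -/
theorem index_centralizer_le_mul_pow {p : ℕ} [hp : Fact p.Prime] [Finite G] (hG : IsPGroup p G)
    {b : ℕ} (h : ∀ x : G, (centralizer {x}).index ≤ p ^ b) {e : ℕ} {K H : Subgroup G}
    (hKH : K ≤ H) (he : K.relIndex H ≤ p ^ e) :
    (centralizer (H : Set G)).index ≤ (centralizer (K : Set G)).index * p ^ (b * e) := by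
  induction e generalizing K with
  | zero =>
    have h1 : K.relIndex H = 1 :=
      le_antisymm he (Nat.one_le_iff_ne_zero.2 index_ne_zero_of_finite)
    rw [le_antisymm hKH (relIndex_eq_one.1 h1), mul_zero, pow_zero, mul_one]
  | succ e ih =>
    rcases hKH.eq_or_lt with rfl | hlt
    · exact Nat.le_mul_of_pos_right _ (pow_pos hp.out.pos _)
    obtain ⟨x, hxH, hxK⟩ := SetLike.exists_of_lt hlt
    have hK : K < K ⊔ zpowers x :=
      left_lt_sup.2 fun hx => hxK (hx (mem_zpowers x))
    have hle : K ⊔ zpowers x ≤ H := sup_le hKH (zpowers_le.2 hxH)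
    have hrel : (K ⊔ zpowers x).relIndex H ≤ p ^ e := by
      refine le_of_mul_le_mul_left ?_ hp.out.pos
      calc p * (K ⊔ zpowers x).relIndex H
          ≤ K.relIndex (K ⊔ zpowers x) * (K ⊔ zpowers x).relIndex H :=
            Nat.mul_le_mul_right _ (le_relIndex_of_lt hG hK)
        _ = K.relIndex H := relIndex_mul_relIndex _ _ _ hK.le hle
        _ ≤ p ^ (e + 1) := he
        _ = p * p ^ e := pow_succ' p e
    calc (centralizer (H : Set G)).index
        ≤ (centralizer ((K ⊔ zpowers x : Subgroup G) : Set G)).index * p ^ (b * e) := ih hle hrel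
      _ ≤ ((centralizer (K : Set G)).index * p ^ b) * p ^ (b * e) :=
          Nat.mul_le_mul_right _ ((index_centralizer_sup_zpowers_le K x).trans
            (Nat.mul_le_mul_left _ (h x)))
      _ = (centralizer (K : Set G)).index * p ^ (b * (e + 1)) := by ring

/-- In a finite `p`-group, a partial transversal `F` of `C` in an intermediate subgroup `D` of
index at most `p ^ m` extends to all of `G` at the cost of adjoining at most `m` elements. -/
theorem exists_le_forall_exists_mem_inv_mul_mem {p : ℕ} [hp : Fact p.Prime] [Finite G]
    (hG : IsPGroup p G) {b : ℕ} (h : ∀ x : G, (centralizer {x}).index ≤ p ^ b) {C : Subgroup G}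
    {m : ℕ} {D F : Subgroup G} (hD : D.index ≤ p ^ m) (hDF : ∀ g ∈ D, ∃ t ∈ F, t⁻¹ * g ∈ C) :
    ∃ F' : Subgroup G, F ≤ F' ∧ (∀ g : G, ∃ t ∈ F', t⁻¹ * g ∈ C) ∧
      (centralizer (F' : Set G)).index ≤ (centralizer (F : Set G)).index * p ^ (b * m) := by
  induction m generalizing D F with
  | zero =>
    have h1 : D.index = 1 :=
      le_antisymm hD (Nat.one_le_iff_ne_zero.2 index_ne_zero_of_finite)
    refine ⟨F, le_rfl, fun g => hDF g (index_eq_one.1 h1 ▸ mem_top g), ?_⟩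
    simp
  | succ m ih =>
    rcases eq_or_ne D ⊤ with rfl | hDtop
    · exact ⟨F, le_rfl, fun g => hDF g (mem_top g),
        Nat.le_mul_of_pos_right _ (pow_pos hp.out.pos _)⟩
    have : Group.IsNilpotent G := hG.isNilpotent
    -- Since `x` normalizes `D`, the join is the product set `⟨x⟩D`, and products `z * t` represent
    -- its cosets of `C`.
    obtain ⟨x, hxN, hxD⟩ := SetLike.exists_of_lt
      (Group.normalizerCondition_of_isNilpotent D (lt_top_iff_ne_top.2 hDtop))
    have hlt : D < zpowers x ⊔ D :=
      right_lt_sup.2 fun hx => hxD (hx (mem_zpowers x))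
    obtain ⟨F', hF, hF', hidx⟩ := ih (D := zpowers x ⊔ D) (F := F ⊔ zpowers x)
      (index_le_pow_of_lt hG hlt hD) (fun g hg => by
        rw [← SetLike.mem_coe, coe_mul_of_left_le_normalizer_right _ _ (zpowers_le.2 hxN)] at hg
        obtain ⟨z, hz, d, hd, rfl⟩ := hg
        obtain ⟨t, ht, htd⟩ := hDF d hd
        refine ⟨z * t, mul_mem (mem_sup_right hz) (mem_sup_left ht), ?_⟩
        rwa [mul_inv_rev, mul_assoc, inv_mul_cancel_left])
    refine ⟨F', le_sup_left.trans hF, hF', hidx.trans ?_⟩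
    calc (centralizer ((F ⊔ zpowers x : Subgroup G) : Set G)).index * p ^ (b * m)
        ≤ ((centralizer (F : Set G)).index * p ^ b) * p ^ (b * m) :=
          Nat.mul_le_mul_right _ ((index_centralizer_sup_zpowers_le F x).trans
            (Nat.mul_le_mul_left _ (h x)))
      _ = (centralizer (F : Set G)).index * p ^ (b * (m + 1)) := by ring

/-! ### Elements of maximal breadth -/

/-- Representatives in `F` of distinct cosets of `C` stay distinct modulo `D`; as `D` has no more
cosets than `C`, they exhaust them. -/
theorem exists_mem_inv_mul_mem_of_index_le [Finite G] {C D F : Subgroup G}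
    (hC : ∀ g : G, ∃ t ∈ F, t⁻¹ * g ∈ C) (hCD : ∀ t ∈ F, t ∈ D → t ∈ C)
    (hidx : D.index ≤ C.index) (g : G) : ∃ t ∈ F, t⁻¹ * g ∈ D := by
  choose τ hτF hτC using hC
  let φ : G ⧸ C → G ⧸ D := fun q => (τ q.out : G)
  have hφ : Function.Injective φ := by
    intro q r hqr
    have h1 := hCD _ (mul_mem (inv_mem (hτF q.out)) (hτF r.out)) (QuotientGroup.eq.1 hqr)
    have hq : ((τ q.out : G) : G ⧸ C) = q := (QuotientGroup.eq.2 (hτC _)).trans q.out_eq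
    have hr : ((τ r.out : G) : G ⧸ C) = r := (QuotientGroup.eq.2 (hτC _)).trans r.out_eq
    rw [← hq, ← hr]
    exact QuotientGroup.eq.2 h1
  obtain ⟨q, hq⟩ := (hφ.bijective_of_nat_card_le hidx).2 (g : G ⧸ D)
  exact ⟨τ q.out, hτF _, QuotientGroup.eq.1 hq⟩

/-- If `x` has maximal breadth, `F` contains a transversal of its centralizer, and `y`
centralizes `F`, then all commutators of `y` lie in the normal closure of `x`. -/
theorem commutatorElement_mem_normalClosure_of_mem_centralizer [Finite G] {F : Subgroup G} {x y : G}
    (hmax : ∀ z : G, (centralizer {z}).index ≤ (centralizer {x}).index)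
    (hF : ∀ g : G, ∃ t ∈ F, t⁻¹ * g ∈ centralizer {x}) (hy : y ∈ centralizer (F : Set G)) (g : G) :
    ⁅g, y⁆ ∈ normalClosure {x} := by
  have hcomm (t : G) (ht : t ∈ F) : t * y = y * t := mem_centralizer_iff.1 hy t ht
  obtain ⟨t, htF, ht⟩ := exists_mem_inv_mul_mem_of_index_le (D := centralizer {x * y}) hF
    (fun t ht htxy => by
      rw [mem_centralizer_singleton_iff] at htxy ⊢
      refine mul_right_cancel (b := y) ?_
      rw [mul_assoc, htxy, mul_assoc, mul_assoc, hcomm t ht]) (hmax _) g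
  rw [mem_centralizer_singleton_iff] at ht
  -- `g` and `t` conjugate `x * y` alike, and `t` fixes `y`.
  have hgt : g * (x * y) * g⁻¹ = t * x * t⁻¹ * y := by
    have h1 : g * (x * y) * g⁻¹ = t * (t⁻¹ * g * (x * y)) * g⁻¹ := by group
    rw [h1, ht]
    have h2 : t⁻¹ * y = y * t⁻¹ := hcomm _ (inv_mem htF)
    calc t * (x * y * (t⁻¹ * g)) * g⁻¹ = t * x * (y * t⁻¹) := by group
      _ = t * x * t⁻¹ * y := by rw [← h2]; group
  have hmem (g : G) : g * x * g⁻¹ ∈ normalClosure {x} :=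
    normalClosure_normal.conj_mem x (subset_normalClosure (Set.mem_singleton x)) g
  have hcalc : ⁅g, y⁆ = (g * x * g⁻¹)⁻¹ * (t * x * t⁻¹) := by
    calc ⁅g, y⁆ = (g * x * g⁻¹)⁻¹ * (g * (x * y) * g⁻¹) * y⁻¹ := by
          rw [commutatorElement_def]; group
      _ = _ := by rw [hgt]; group
  rw [hcalc]
  exact mul_mem (inv_mem (hmem g)) (hmem t)

/-- Every conjugate of `x` is already a conjugate by an element of `F`. -/
theorem normalClosure_singleton_le {F : Subgroup G} {x : G} (hx : x ∈ F)
    (hF : ∀ g : G, ∃ t ∈ F, t⁻¹ * g ∈ centralizer {x}) : normalClosure {x} ≤ F := by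
  refine (closure_le F).2 fun z hz => ?_
  obtain ⟨a, rfl, hconj⟩ := Group.mem_conjugatesOfSet_iff.1 hz
  obtain ⟨g, rfl⟩ := isConj_iff.1 hconj
  obtain ⟨t, ht, htg⟩ := hF g
  rw [mem_centralizer_singleton_iff] at htg
  have : g * a * g⁻¹ = t * a * t⁻¹ := by
    have h1 : g * a * g⁻¹ = t * (t⁻¹ * g * a) * g⁻¹ := by group
    rw [h1, htg]
    group
  rw [SetLike.mem_coe, this]
  exact mul_mem (mul_mem ht hx) (inv_mem ht)

/-- In a finite `p`-group of breadth at most `b`, the index of the centralizer of the commutator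
subgroup is bounded in terms of `p` and `b`. -/
theorem index_centralizer_commutator_le {p : ℕ} [hp : Fact p.Prime] [Finite G] (hG : IsPGroup p G)
    {b : ℕ} (h : ∀ x : G, (centralizer {x}).index ≤ p ^ b) :
    (centralizer (_root_.commutator G : Set G)).index ≤
      p ^ (b * (b + 1) + b * (b * (b + 1) * (b * (b + 1)))) := by
  obtain ⟨x, hx⟩ := Finite.exists_max fun x : G => (centralizer {x}).index
  obtain ⟨F, hxF, hF, hidx⟩ := exists_le_forall_exists_mem_inv_mul_mem hG h
    (C := centralizer {x}) (F := zpowers x) (h x)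
    fun g hg => ⟨1, one_mem _, by rwa [inv_one, one_mul]⟩
  replace hxF : x ∈ F := hxF (mem_zpowers x)
  -- One factor `p ^ b` for `x` and one for each of the at most `b` adjoined elements.
  have hFidx : (centralizer (F : Set G)).index ≤ p ^ (b * (b + 1)) := by
    refine hidx.trans ?_
    rw [zpowers_eq_closure, centralizer_closure, mul_add, mul_one, add_comm, pow_add]
    exact Nat.mul_le_mul_right _ (h x)
  have hVF := normalClosure_singleton_le hxF hF
  let V := normalClosure {x}
  have hcenter : centralizer (F : Set G) ≤ (center (G ⧸ V)).comap (QuotientGroup.mk' V) := by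
    intro y hy
    rw [mem_comap, mem_center_iff]
    intro g
    obtain ⟨g, rfl⟩ := QuotientGroup.mk_surjective g
    exact commutatorElement_eq_one_iff_mul_comm.1 ((QuotientGroup.eq_one_iff _).2
      (commutatorElement_mem_normalClosure_of_mem_centralizer hx hF hy g))
  have hquot := card_commutator_le_pow_of_index_center_le (b * (b + 1)) (hG.to_quotient V) (by
    rw [← index_comap_of_surjective (center (G ⧸ V)) (QuotientGroup.mk'_surjective V)]
    exact (index_antitone hcenter).trans hFidx)
  let H := (_root_.commutator (G ⧸ V)).comap (QuotientGroup.mk' V)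
  have hVH : V ≤ H := fun v hv => by
    rw [mem_comap, QuotientGroup.mk'_apply, (QuotientGroup.eq_one_iff v).2 hv]
    exact one_mem _
  have hrel : V.relIndex H = Nat.card (_root_.commutator (G ⧸ V)) := by
    conv_lhs => rw [← QuotientGroup.ker_mk' V]
    rw [relIndex_ker, map_comap_eq_self_of_surjective (QuotientGroup.mk'_surjective V)]
  have hGH : _root_.commutator G ≤ H := by
    rw [← map_le_iff_le_comap, _root_.map_commutator_eq]
    exact commutator_mono le_top le_top
  calc (centralizer (_root_.commutator G : Set G)).index
      ≤ (centralizer (H : Set G)).index := index_antitone (centralizer_le hGH)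
    _ ≤ (centralizer (V : Set G)).index * p ^ (b * (b * (b + 1) * (b * (b + 1)))) :=
        index_centralizer_le_mul_pow hG h hVH (hrel.trans_le hquot)
    _ ≤ p ^ (b * (b + 1)) * p ^ (b * (b * (b + 1) * (b * (b + 1)))) :=
        Nat.mul_le_mul_right _ ((index_antitone (centralizer_le hVF)).trans hFidx)
    _ = _ := (pow_add _ _ _).symm

/-- The derived subgroup of the centralizer of `G'` is central in `G`, by the three subgroups lemma.
-/
theorem nilpotencyClass_centralizer_commutator_le_two
    [Group.IsNilpotent (centralizer (_root_.commutator G : Set G))] :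
    Group.nilpotencyClass (centralizer (_root_.commutator G : Set G)) ≤ 2 := by
  rw [← lowerCentralSeries_eq_bot_iff_nilpotencyClass_le]
  apply map_injective (centralizer (_root_.commutator G : Set G)).subtype_injective
  rw [top_subtype_lowerCentralSeries, map_bot]
  refine eq_bot_iff.2 ((commutator_mono (commutator_centralizer_commutator_le_center G)
    le_rfl).trans ?_)
  rw [commutator_center_left]

end Subgroup

/-! ### Numerical estimate and conclusion -/

theorem Real.mul_le_iterate_mul_add_one {x : ℝ} {b : ℕ} (hb : (b : ℝ) ≤ x) :
    x * (((b : ℝ) + 1) * (1 + b * (b * (b + 1)))) ≤ (fun x : ℝ => x * (x + 1))^[b + 1] x := by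
  have hx : 0 ≤ x := b.cast_nonneg.trans hb
  have hmono (n : ℕ) (y : ℝ) (hy : 0 ≤ y) : y ≤ (fun x : ℝ => x * (x + 1))^[n] y := by
    induction n generalizing y with
    | zero => exact le_rfl
    | succ n ih =>
      rw [Function.iterate_succ_apply]
      exact le_trans (by nlinarith) (ih (y * (y + 1)) (by positivity))
  match b with
  | 0 => simpa using hmono 1 x hx
  | 1 =>
    simp only [Nat.cast_one] at hb
    simp only [Function.iterate_succ_apply, Function.iterate_zero_apply, Nat.cast_one]
    have h1 : 2 ≤ x * (x + 1) := by nlinarith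
    have h2 : 2 * 3 ≤ (x + 1) * (x * (x + 1) + 1) := by gcongr <;> linarith
    nlinarith
  | b + 2 =>
    rw [Function.iterate_succ_apply, Function.iterate_succ_apply, Function.iterate_succ_apply]
    -- For breadth at least 2, three iterates suffice: `f^3(x) = x(x+1)(f(x)+1)(f^2(x)+1)` is
    -- compared factor by factor.
    refine le_trans ?_ (hmono b _ (by positivity))
    set c : ℝ := ((b + 2 : ℕ) : ℝ)
    have hc : 0 ≤ c := Nat.cast_nonneg _
    have h1 : c ≤ x * (x + 1) := by nlinarith
    have h2 : c ≤ x * (x + 1) * (x * (x + 1) + 1) := by nlinarith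
    calc x * ((c + 1) * (1 + c * (c * (c + 1))))
        ≤ x * ((c + 1) * ((c * (c + 1) + 1) * (c + 1))) := by
          gcongr
          nlinarith
      _ ≤ x * ((x + 1) * ((x * (x + 1) + 1) * (x * (x + 1) * (x * (x + 1) + 1) + 1))) := by gcongr
      _ = _ := by ring

theorem theorem4 {p : ℕ} [Fact p.Prime] (hp : 2 < p)
    {G : Type*} [Group G] [Finite G] [Nontrivial G] (hG : IsPGroup p G) :
    ∃ N : Subgroup G,
      N.Characteristic ∧
      (∀ φ : G →* G, Function.Surjective φ → N.map φ ≤ N) ∧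
      Real.logb 2 (N.index : ℝ) ≤
        (fun x : ℝ => x * (x + 1))^[groupBreadth p G + 1]
          ((groupBreadth p G : ℝ) * Real.logb 2 (p : ℝ)) ∧
      Group.IsNilpotent N ∧
      Group.nilpotencyClass N ≤ groupBreadth p G + 1 := by
  set b := groupBreadth p G
  have hprime : p.Prime := Fact.out
  have hbr (x : G) : (Subgroup.centralizer {x}).index ≤ p ^ b := by
    rw [← pow_elementBreadth hG x]
    exact Nat.pow_le_pow_right hprime.pos ((isGreatest_groupBreadth p G).2 ⟨x, rfl⟩)
  have hchar : (Subgroup.centralizer (commutator G : Set G)).Characteristic :=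
    Subgroup.characteristic_centralizer
  refine ⟨Subgroup.centralizer (commutator G : Set G), hchar, fun φ hφ => ?_, ?_, ?_, ?_⟩
  · let ψ : G ≃* G := MulEquiv.ofBijective φ ⟨Finite.injective_iff_surjective.2 hφ, hφ⟩
    exact Subgroup.characteristic_iff_map_le.1 hchar ψ
  · have hidx : (Subgroup.centralizer (commutator G : Set G)).index ≤
        p ^ (b * (b + 1) + b * (b * (b + 1) * (b * (b + 1)))) :=
      Subgroup.index_centralizer_commutator_le hG hbr
    have hL : 1 ≤ Real.logb 2 (p : ℝ) := by
      rw [Real.le_logb_iff_rpow_le one_lt_two (by exact_mod_cast hprime.pos), Real.rpow_one]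
      exact_mod_cast hp.le
    have h0 : (0 : ℝ) < (Subgroup.centralizer (commutator G : Set G)).index := by
      exact_mod_cast Nat.pos_of_ne_zero Subgroup.index_ne_zero_of_finite
    calc Real.logb 2 ((Subgroup.centralizer (commutator G : Set G)).index : ℝ)
        ≤ Real.logb 2 ((p : ℝ) ^ (b * (b + 1) + b * (b * (b + 1) * (b * (b + 1))))) :=
          Real.logb_le_logb_of_le one_lt_two h0 (by exact_mod_cast hidx)
      _ = (b * Real.logb 2 (p : ℝ)) * (((b : ℝ) + 1) * (1 + b * (b * (b + 1)))) := by
          rw [Real.logb_pow]; push_cast; ring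
      _ ≤ _ := Real.mul_le_iterate_mul_add_one (le_mul_of_one_le_right b.cast_nonneg hL)
  · exact (hG.to_subgroup _).isNilpotent
  · have : Group.IsNilpotent (Subgroup.centralizer (commutator G : Set G)) :=
      (hG.to_subgroup _).isNilpotent
    -- Class 2 is too weak when `b = 0`; there `G` is abelian.
    rcases Nat.eq_zero_or_pos b with hb0 | hb0
    · have hc : Subgroup.center G = ⊤ := eq_top_iff.2 fun x _ => by
        have h1 : (Subgroup.centralizer {x}).index = 1 :=
          le_antisymm (by simpa [hb0] using hbr x)
            (Nat.one_le_iff_ne_zero.2 Subgroup.index_ne_zero_of_finite)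
        exact Subgroup.mem_center_iff.2 fun g => Subgroup.mem_centralizer_singleton_iff.1
          (Subgroup.index_eq_one.1 h1 ▸ Subgroup.mem_top g)
      rw [hb0, zero_add, Group.IsNilpotent.nilpotencyClass_le_one_iff]
      have : IsMulCommutative G := Subgroup.center_eq_top_iff.1 hc
      infer_instance
    · exact Subgroup.nilpotencyClass_centralizer_commutator_le_two.trans (by omega)
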